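/- \textbf{Setting.} Let $\mathcal D_u$ (natural samples), $\mathcal D$ (augmented samples, $|\mathcal D|=N$) and $\mathcal Y$ (classes) be finite sets, $\mathcal P_u$ a probability distribution on $\mathcal D_u$, and $\mathcal A(\cdot\mid\bar x)$ a probability distribution on $\mathcal D$ for each $\bar x\in\mathcal D_u$, such that every $x\in\mathcal D$ is generated with positive probability. Every natural and every augmented sample has a label $y(\bar x),y(x)\in\mathcal Y$. Put $A_{xx'}=\mathbb E_{\bar x\sim\mathcal P_u}[\mathcal A(x\mid\bar x)\mathcal A(x'\mid\bar x)]$, $D_{xx}=\sum_{x'}A_{xx'}$ and $\bar A=D^{-1/2}AD^{-1/2}$. Let $\sigma_1\ge\dots\ge\sigma_N\ge 0$ be the eigenvalues of $\bar A$, put $\sigma_{N+1}=0$, and let $\alpha=\mathbb E_{\bar x\sim\mathcal P_u}\mathbb E_{x\sim\mathcal A(\cdot\mid\bar x)}\mathbf 1[y(\bar x)\ne y(x)]$. Below, $(x,x^+)$ has law $A$, and $x,x^-$ are independent with law $x\mapsto D_{xx}$. Let $1\le k\le N$. An optimal SCL encoder $f^\star_{SCL}:\mathcal D\to\mathbb R^k$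 minimizes $-2\,\mathbb E_{x,x^+}f(x)^\top f(x^+)+\mathbb E_{x}\mathbb E_{x^-}(f(x)^\top f(x^-))^2$ over all $f:\mathcal D\to\mathbb R^k$. An optimal triCL solution $(f^\star_{triCL},S^\star)$ minimizes $$-2\,\mathbb E_{x,x^+}f(x)^\top Sf(x^+)+\mathbb E_{x}\mathbb E_{x^-}(f(x)^\top Sf(x^-))^2+\|\mathbb E_xf(x)f(x)^\top-I\|_F^2$$ over all $f:\mathcal D\to\mathbb R^k$ and all $S=\mathrm{diag}(s_1,\dots,s_k)$ with $s_1\ge\dots\ge s_k\ge0$. For features $f:\mathcal D\to\mathbb R^n$, a matrix $W\in\mathbb R^{\mathcal Y\times n}$ predicts the class $\arg\max_c (Wf(x))_c$ for the view $x$, and predicts for a natural sample $\bar x$ the class predicted with the largest probability over its views $x\sim\mathcal A(\cdot\mid\bar x)$; ties are broken by an arbitrary fixed rule. The linear probing error $\mathcal E(f)$ is the minimum over $W$ of the probability that the class predicted for $\bar x\sim\mathcal P_u$ differs from $y(\bar x)$. \textbf{Theorem.} There are absolute constants $c_1,c_2>0$ such that the following holds in every such setting, for all optimal solutions $f^\star_{SCL}$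 and $(f^\star_{triCL},S^\star)$. (1) With all $k$ features, $$\mathcal E(f^\star_{SCL})\le c_1\sum_{i=k+1}^N\sigma_i^2+c_2\alpha,\qquad \mathcal E(f^\star_{triCL})\le c_1\sum_{i=k+1}^N\sigma_i^2+c_2\alpha,$$ and if $\sigma_k>\sigma_{k+1}$, then $\mathcal E(f^\star_{SCL})=\mathcal E(f^\star_{triCL})$. (2) Let $1\le m\le k$. The first $m$ features $f^{\star(m)}_{triCL}$ of $f^\star_{triCL}$ (those with the largest $s_i$) satisfy $$\mathcal E(f^{\star(m)}_{triCL})\le U_{triCL}:=c_1\sum_{i=m+1}^N\sigma_i^2+c_2\alpha .$$ (3) Let $1\le m\le k$. If $f^{\star(m)}_{SCL}$ consists of $m$ features of $f^\star_{SCL}$ that are chosen uniformly at random, then $$\mathbb E\,\mathcal E(f^{\star(m)}_{SCL})\le U_{SCL}:=c_1\Big(\big(1-\tfrac mk\big)\sum_{i=1}^k\sigma_i^2+\sum_{i=k+1}^N\sigma_i^2\Big)+c_2\alpha .$$ (4) For $1\le m\le k$, $$U_{SCL}-U_{triCL}\ \ge\ \frac{m(k-m)}{k}\Big(\frac1m\sum_{i=1}^m\sigma_i^2-\frac1{k-m}\sum_{i=m+1}^k\sigma_i^2\Big)\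 \ge\ 0,$$ where the middle expression is read as $0$ for $m=k$. -/

import Mathlib

open scoped Matrix

noncomputable section

namespace TriCL

/-- The data of the contrastive learning problem: finite sets `Xbar` of natural samples, `X` of
augmented samples and `Y` of classes, the distribution `P` of natural samples, the augmentation
distributions `aug xbar = 𝒜(· | xbar)`, and the ground-truth labels of natural and of augmented
samples. Every augmented sample is produced with positive probability (so that the degrees of the
augmentation graph are positive). -/
structure Model (Xbar X Y : Type*) [Fintype Xbar] [Fintype X] where
  P : Xbar → ℝ
  P_mem : P ∈ stdSimplex ℝ Xbar
  aug : Xbar → X → ℝ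
  aug_mem : ∀ xbar, aug xbar ∈ stdSimplex ℝ X
  exists_pos : ∀ x, ∃ xbar, 0 < P xbar * aug xbar x
  natLabel : Xbar → Y
  augLabel : X → Y

variable {Xbar X Y : Type*} [Fintype Xbar] [Fintype X] (M : Model Xbar X Y)

namespace Model

/-- Adjacency matrix of the augmentation graph: the probability of the positive pair `(x, x')`. -/
def adj : Matrix X X ℝ :=
  Matrix.of fun x x' => ∑ xbar, M.P xbar * (M.aug xbar x * M.aug xbar x')

/-- Degree `D_{xx}`, which is also the probability of the augmented sample `x`. -/
def deg (x : X) : ℝ := ∑ x', M.adj x x'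

/-- Normalized adjacency matrix `D^{-1/2} A D^{-1/2}`. -/
def normAdj : Matrix X X ℝ :=
  Matrix.of fun x x' => M.adj x x' / (√(M.deg x) * √(M.deg x'))

theorem normAdj_isHermitian : M.normAdj.IsHermitian := by
  ext x x'
  simp [normAdj, adj, mul_comm]

/-- `M.sigma i` is the `(i+1)`-st largest eigenvalue, with multiplicity, of the normalized
adjacency matrix (a positive semidefinite matrix, so this is also its `(i+1)`-st largest singular
value); it is `0` for `i ≥ N`, where `N` is the number of augmented samples. -/
def sigma [DecidableEq X] (i : ℕ) : ℝ :=
  if h : i < Fintype.card X then M.normAdj_isHermitian.eigenvalues₀ ⟨i, h⟩ else 0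

/-- The probability that a natural sample and a view of it have different labels. -/
def alpha [DecidableEq Y] : ℝ :=
  ∑ xbar, M.P xbar *
    ∑ x, M.aug xbar x * (if M.natLabel xbar ≠ M.augLabel x then 1 else 0)

/-- Spectral contrastive loss
`-2 𝔼_{x,x⁺} f(x)ᵀ f(x⁺) + 𝔼_x 𝔼_{x⁻} (f(x)ᵀ f(x⁻))²`. -/
def lossSCL {k : ℕ} (f : X → Fin k → ℝ) : ℝ :=
  -2 * (∑ x, ∑ x', M.adj x x' * (f x ⬝ᵥ f x')) +
    ∑ x, ∑ x', M.deg x * M.deg x' * (f x ⬝ᵥ f x') ^ 2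

/-- Tri-term contrastive loss with importance matrix `S = diag(s)`. -/
def lossTri {k : ℕ} (f : X → Fin k → ℝ) (s : Fin k → ℝ) : ℝ :=
  -2 * (∑ x, ∑ x', M.adj x x' * (f x ⬝ᵥ (Matrix.diagonal s *ᵥ f x'))) +
    ∑ x, ∑ x', M.deg x * M.deg x' * (f x ⬝ᵥ (Matrix.diagonal s *ᵥ f x')) ^ 2

/-- Decorrelation loss `‖𝔼_x f(x) f(x)ᵀ - I‖²` (squared Frobenius norm). -/
def lossDec {k : ℕ} (f : X → Fin k → ℝ) : ℝ :=
  ∑ i, ∑ j, ((∑ x, M.deg x * (f x i * f x j)) - (1 : Matrix (Fin k) (Fin k) ℝ) i j) ^ 2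

/-- The triCL objective. -/
def lossTriCL {k : ℕ} (f : X → Fin k → ℝ) (s : Fin k → ℝ) : ℝ :=
  M.lossTri f s + M.lossDec f

/-- `f` is an optimal solution of SCL, among all encoders with `k` features. -/
def IsOptimalSCL {k : ℕ} (f : X → Fin k → ℝ) : Prop :=
  ∀ g : X → Fin k → ℝ, M.lossSCL f ≤ M.lossSCL g

/-- Admissible importance vectors: `s_1 ≥ ⋯ ≥ s_k ≥ 0`. -/
def IsImportance {k : ℕ} (s : Fin k → ℝ) : Prop := Antitone s ∧ ∀ i, 0 ≤ s i

/-- `(f, s)` is an optimal solution of triCL, among all encoders with `k` features and all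
admissible importance vectors. -/
def IsOptimalTriCL {k : ℕ} (f : X → Fin k → ℝ) (s : Fin k → ℝ) : Prop :=
  IsImportance s ∧
    ∀ (g : X → Fin k → ℝ) (t : Fin k → ℝ), IsImportance t → M.lossTriCL f s ≤ M.lossTriCL g t

end Model

/-- `a` picks a maximizing class of every score vector; the rule for breaking ties is arbitrary
(but fixed, as a function of the score vector). -/
def IsArgmax (a : (Y → ℝ) → Y) : Prop := ∀ (v : Y → ℝ) (c : Y), v c ≤ v (a v)

section Probing

variable {ι : Type*} [Fintype ι] [DecidableEq Y]

/-- The class that the linear classifier with weights `W` predicts from the feature vector `z`. -/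
def linPredict (a : (Y → ℝ) → Y) (W : Matrix Y ι ℝ) (z : ι → ℝ) : Y := a (W *ᵥ z)

/-- The class predicted for a natural sample: the one that the linear classifier predicts most
often on the random views of the sample. -/
def Model.ensemble (a : (Y → ℝ) → Y) (f : X → ι → ℝ) (W : Matrix Y ι ℝ) (xbar : Xbar) : Y :=
  a fun c => ∑ x, M.aug xbar x * (if linPredict a W (f x) = c then 1 else 0)

/-- Classification error on natural samples of the linear classifier with weights `W`. -/
def Model.classError (a : (Y → ℝ) → Y) (f : X → ι → ℝ) (W : Matrix Y ι ℝ) : ℝ :=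
  ∑ xbar, M.P xbar * (if M.ensemble a f W xbar ≠ M.natLabel xbar then 1 else 0)

/-- Linear probing error: the least classification error of a linear classifier on the features
`f` (the infimum is a minimum, since the error takes finitely many values). -/
def Model.probeError (a : (Y → ℝ) → Y) (f : X → ι → ℝ) : ℝ :=
  ⨅ W : Matrix Y ι ℝ, M.classError a f W

end Probing

/-- The features of `f` with index in `T`. -/
def selectFeatures {k : ℕ} (f : X → Fin k → ℝ) (T : Finset (Fin k)) : X → T → ℝ :=
  fun x i => f x i

/-- The first `m` features of `f`. -/
def topFeatures {k : ℕ} (f : X → Fin k → ℝ) (m : ℕ) (h : m ≤ k) : X → Fin m → ℝ :=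
  fun x i => f x (Fin.castLE h i)

/-- Expected linear probing error of `m` features of `f`, chosen uniformly at random. -/
def Model.randomProbeError [DecidableEq Y] (a : (Y → ℝ) → Y) {k : ℕ} (f : X → Fin k → ℝ)
    (m : ℕ) : ℝ :=
  (∑ T ∈ Finset.powersetCard m (Finset.univ : Finset (Fin k)),
    M.probeError a (selectFeatures f T)) / (k.choose m : ℝ)

/-- The bound `c₁ ∑_{i>m} σ_i² + c₂ α`. -/
def Model.boundTop [DecidableEq X] [DecidableEq Y] (c₁ c₂ : ℝ) (m : ℕ) : ℝ :=
  c₁ * ∑ i ∈ Finset.Ico m (Fintype.card X), M.sigma i ^ 2 + c₂ * M.alpha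

/-- The bound `c₁ ((1 - m/k) ∑_{i≤k} σ_i² + ∑_{i>k} σ_i²) + c₂ α`. -/
def Model.boundRandom [DecidableEq X] [DecidableEq Y] (c₁ c₂ : ℝ) (k m : ℕ) : ℝ :=
  c₁ * ((1 - (m : ℝ) / k) * ∑ i ∈ Finset.range k, M.sigma i ^ 2 +
    ∑ i ∈ Finset.Ico k (Fintype.card X), M.sigma i ^ 2) + c₂ * M.alpha

/-- `(m(k-m)/k) (1/m ∑_{i≤m} σ_i² - 1/(k-m) ∑_{m<i≤k} σ_i²)`; it is `0` for `m = k`. -/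
def Model.gap [DecidableEq X] (k m : ℕ) : ℝ :=
  (m : ℝ) * ((k : ℝ) - m) / k *
    (1 / (m : ℝ) * ∑ i ∈ Finset.range m, M.sigma i ^ 2 -
      1 / ((k : ℝ) - m) * ∑ i ∈ Finset.Ico m k, M.sigma i ^ 2)

end TriCL

end

/-!
Write `G j` for the `j`-th feature, weighted by `√deg`, as a vector indexed by the augmented
samples, `T` for the operator of the normalized adjacency matrix and `u c` for the weighted
indicator vector of the class `c`. Up to the constant `‖T‖²` (Frobenius norms throughout), the
SCL loss is `‖T - G Gᵀ‖²` and the triCL loss is `‖T - G S Gᵀ‖² + ‖Gᵀ G - 1‖²`. The leading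
eigenvectors show that both minima are at most `∑_{i>k} σ_i²`, the Eckart–Young minimum.

*Probing error.* For features `G` and any weights `s`, put `B = G diag(s) Gᵀ`. The vectors `B u_c`
are given by a linear classifier on the features, so its regression error is
`∑_c ‖B u_c - u_c‖² ≤ 2 ∑_c ‖(T - B) u_c‖² + 2 ∑_c ‖T u_c - u_c‖²`. The first sum is at most
`‖T - B‖²`, because the `u_c` are orthogonal of norm at most one; the second is at most `4 α`,
because a positive pair has two different labels with probability at most `2 α`. A wrong argmax
costs regression error at least `1/2`, and a wrong majority vote needs at least half of its views to
be wrong. This gives `probeError_le`: the error is at most `8 ‖T - B‖² + 34 α`. No spectral gap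
or eigenvalue estimate enters, and every bound of the theorem is a bound on `‖T - B‖²`.

*Optimal solutions.* If `B` has range in a space `V` of dimension at most `k` and is as good as the
truncated eigendecomposition, then `B` is the projection of `T` to `V`, and `V` captures the weight
`∑_{i≤k} σ_i²` (`eq_projection_of_optimal`). For triCL the Eckart–Young lower bound forces the
decorrelation loss to vanish, so that the features are orthonormal; symmetry then makes them
eigenvectors with eigenvalues `s_j`, and `s_j = σ_j` as `s` is sorted. Hence the first `m` features
leave exactly `∑_{i>m} σ_i²`. If `σ_k > σ_{k+1}`, both solutions span the space of the `k` leading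
eigenvectors and are linear functions of each other.

*Random features.* For an optimal SCL encoder, keeping only the features in a set `T` adds to
the error `‖∑_{j∉T} G_j G_jᵀ‖² ≤ ∑_{j∉T} ∑_l ⟪G_j, G_l⟫²`. A random `m`-subset misses each `j`
with probability `1 - m/k`, and `∑_{j,l} ⟪G_j, G_l⟫² = ‖B‖² = ∑_{i≤k} σ_i²`.
-/

noncomputable section

namespace TriCL

open scoped InnerProductSpace
open Module

/-! ### Weighted sums dominated by the largest weights -/

section Weights

theorem sum_fin_ite_lt {N k : ℕ} (hk : k ≤ N) (g : ℕ → ℝ) :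
    ∑ i : Fin N, (if (i : ℕ) < k then g i else 0) = ∑ i ∈ Finset.range k, g i := by
  rw [Fin.sum_univ_eq_sum_range (fun i => if i < k then g i else 0) N, ← Finset.sum_filter]
  congr 1
  ext i
  simp only [Finset.mem_filter, Finset.mem_range]
  omega

theorem sum_fin_eq_range_add_Ico {N k : ℕ} (hk : k ≤ N) (g : ℕ → ℝ) :
    ∑ i : Fin N, g i = ∑ i ∈ Finset.range k, g i + ∑ i ∈ Finset.Ico k N, g i := by
  rw [Fin.sum_univ_eq_sum_range g N, Finset.sum_range_add_sum_Ico _ hk]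

variable {N k : ℕ} {w : ℕ → ℝ} {p : Fin N → ℝ}

/-- The deficit of a weighted sum against the sum of the `k` largest weights, written as a sum of
terms that are nonnegative when `w` is antitone and nonnegative, `0 ≤ p ≤ 1` and `∑ p ≤ k`. -/
theorem sum_range_sub_sum_mul (hk : k ≤ N) (w : ℕ → ℝ) (p : Fin N → ℝ) :
    ∑ i ∈ Finset.range k, w i - ∑ i : Fin N, w i * p i =
      ∑ i : Fin N, ((if (i : ℕ) < k then 1 else 0) - p i) * (w i - w k) +
        w k * (k - ∑ i, p i) := by
  have h1 := sum_fin_ite_lt hk w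
  have h2 := sum_fin_ite_lt hk (fun _ => w k)
  simp only [Finset.sum_const, Finset.card_range, nsmul_eq_mul] at h2
  have : ∑ i : Fin N, ((if (i : ℕ) < k then (1 : ℝ) else 0) - p i) * (w i - w k) =
      ∑ i : Fin N, ((if (i : ℕ) < k then w i else 0) - (if (i : ℕ) < k then w k else 0) -
        w i * p i + w k * p i) := by
    refine Finset.sum_congr rfl fun i _ => ?_
    split_ifs <;> ring
  rw [this, Finset.sum_add_distrib, Finset.sum_sub_distrib, Finset.sum_sub_distrib, h1, h2,
    ← Finset.mul_sum]
  ring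

theorem weight_term_nonneg (hw : Antitone w) (p0 : ∀ i, 0 ≤ p i) (p1 : ∀ i, p i ≤ 1)
    (i : Fin N) : 0 ≤ ((if (i : ℕ) < k then 1 else 0) - p i) * (w i - w k) := by
  split_ifs with h
  · exact mul_nonneg (by linarith [p1 i]) (by linarith [hw h.le])
  · exact mul_nonneg_of_nonpos_of_nonpos (by linarith [p0 i]) (by linarith [hw (not_lt.1 h)])

/-- Weights in `[0, 1]` of total mass at most `k` are best spent on the `k` largest values. -/
theorem sum_mul_le_sum_range (hk : k ≤ N) (hw : Antitone w) (hw0 : ∀ i, 0 ≤ w i)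
    (p0 : ∀ i, 0 ≤ p i) (p1 : ∀ i, p i ≤ 1) (hp : ∑ i, p i ≤ k) :
    ∑ i : Fin N, w i * p i ≤ ∑ i ∈ Finset.range k, w i := by
  have h := sum_range_sub_sum_mul hk w p
  have h1 := Finset.sum_nonneg fun i (_ : i ∈ Finset.univ) =>
    weight_term_nonneg (k := k) hw p0 p1 i
  have h2 := mul_nonneg (hw0 k) (sub_nonneg.2 hp)
  linarith

/-- The equality case of `sum_mul_le_sum_range` across a gap of the weights. -/
theorem eq_one_of_sum_range_le (hk : k ≤ N) (hw : Antitone w) (hw0 : ∀ i, 0 ≤ w i)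
    (p0 : ∀ i, 0 ≤ p i) (p1 : ∀ i, p i ≤ 1) (hp : ∑ i, p i ≤ k)
    (h : ∑ i ∈ Finset.range k, w i ≤ ∑ i : Fin N, w i * p i) (hgap : w k < w (k - 1))
    (i : Fin N) (hi : (i : ℕ) < k) : p i = 1 := by
  have hs := sum_range_sub_sum_mul hk w p
  have h2 := mul_nonneg (hw0 k) (sub_nonneg.2 hp)
  have h1 := Finset.single_le_sum (fun i _ => weight_term_nonneg (k := k) hw p0 p1 i)
    (Finset.mem_univ i)
  rw [if_pos hi] at h1
  have hpos : 0 < w i - w k := by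
    have := hw (show (i : ℕ) ≤ k - 1 by omega)
    linarith
  have h3 : (1 - p i) * (w i - w k) ≤ 0 := by linarith
  have := nonpos_of_mul_nonpos_left h3 hpos
  linarith [p1 i]

end Weights

/-! ### Low-rank approximation of a diagonalized symmetric operator -/

section Spectral

variable {E : Type*} [NormedAddCommGroup E] [InnerProductSpace ℝ E]
variable {ι κ : Type*} [Fintype ι] [Fintype κ]

theorem sum_inner_sq (b : OrthonormalBasis ι ℝ E) (z : E) : ∑ i, ⟪z, b i⟫_ℝ ^ 2 = ‖z‖ ^ 2 := by
  rw [← real_inner_self_eq_norm_sq, ← b.sum_inner_mul_inner z z]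
  refine Finset.sum_congr rfl fun i _ => ?_
  rw [real_inner_comm z (b i), sq]

/-- The operator `z ↦ ∑ j, s j ⟪G j, z⟫ G j`, that is, the matrix `G diag(s) Gᵀ` whose factor `G`
has columns `G j`. -/
def lowRank (s : κ → ℝ) (G : κ → E) : E →ₗ[ℝ] E :=
  ∑ j, s j • (innerₛₗ ℝ (G j)).smulRight (G j)

theorem lowRank_apply (s : κ → ℝ) (G : κ → E) (z : E) :
    lowRank s G z = ∑ j, (s j * ⟪G j, z⟫_ℝ) • G j := by
  simp [lowRank, smul_smul]

theorem lowRank_isSymmetric (s : κ → ℝ) (G : κ → E) : (lowRank s G).IsSymmetric := by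
  intro x y
  simp only [lowRank_apply, sum_inner, inner_sum, real_inner_smul_left, real_inner_smul_right]
  refine Finset.sum_congr rfl fun j _ => ?_
  rw [real_inner_comm (G j) x]
  ring

theorem lowRank_mem_span (s : κ → ℝ) (G : κ → E) (z : E) :
    lowRank s G z ∈ Submodule.span ℝ (Set.range G) := by
  rw [lowRank_apply]
  exact Submodule.sum_mem _ fun j _ =>
    Submodule.smul_mem _ _ (Submodule.subset_span ⟨j, rfl⟩)

theorem sum_norm_lowRank_sq (b : OrthonormalBasis ι ℝ E) (s : κ → ℝ) (G : κ → E) :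
    ∑ i, ‖lowRank s G (b i)‖ ^ 2 = ∑ j, ∑ l, s j * s l * ⟪G j, G l⟫_ℝ ^ 2 := by
  simp_rw [← real_inner_self_eq_norm_sq, lowRank_apply, sum_inner, inner_sum,
    real_inner_smul_left, real_inner_smul_right]
  rw [Finset.sum_comm]
  refine Finset.sum_congr rfl fun j _ => ?_
  rw [Finset.sum_comm]
  refine Finset.sum_congr rfl fun l _ => ?_
  rw [sq, ← mul_assoc]
  nth_rw 2 [← b.sum_inner_mul_inner (G j) (G l)]
  rw [Finset.mul_sum, Finset.sum_mul]
  refine Finset.sum_congr rfl fun i _ => ?_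
  rw [real_inner_comm (b i) (G l)]
  ring

variable {N k : ℕ} {b : OrthonormalBasis (Fin N) ℝ E} {T : E →ₗ[ℝ] E} {σ : ℕ → ℝ}

/-- The squared Frobenius norm of `T - G diag(s) Gᵀ`, expanded. -/
theorem sum_norm_sub_lowRank_sq (hs : T.IsSymmetric) (hT : ∀ i, T (b i) = σ i • b i)
    (s : κ → ℝ) (G : κ → E) :
    ∑ i, ‖T (b i) - lowRank s G (b i)‖ ^ 2 =
      ∑ i : Fin N, σ i ^ 2 + (-2 * ∑ j, s j * ⟪G j, T (G j)⟫_ℝ +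
        ∑ j, ∑ l, s j * s l * ⟪G j, G l⟫_ℝ ^ 2) := by
  have h1 : ∑ i, ⟪T (b i), lowRank s G (b i)⟫_ℝ = ∑ j, s j * ⟪G j, T (G j)⟫_ℝ := by
    simp_rw [lowRank_apply, inner_sum, real_inner_smul_right]
    rw [Finset.sum_comm]
    refine Finset.sum_congr rfl fun j _ => ?_
    rw [← b.sum_inner_mul_inner (G j) (T (G j)), Finset.mul_sum]
    refine Finset.sum_congr rfl fun i _ => ?_
    rw [hs (b i) (G j)]
    ring
  simp_rw [norm_sub_sq_real]
  rw [Finset.sum_add_distrib, Finset.sum_sub_distrib, ← Finset.mul_sum, h1,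
    sum_norm_lowRank_sq]
  have h2 : ∀ i, ‖T (b i)‖ ^ 2 = σ i ^ 2 := by
    intro i
    rw [hT, norm_smul, b.norm_eq_one, mul_one, Real.norm_eq_abs, sq_abs]
  simp_rw [h2]
  ring

/-- Eigenvalues `s 0 ≥ s 1 ≥ ⋯` along an orthonormal family of eigenvectors are dominated by the
ordered spectrum. Otherwise the first `j + 1` of them would be orthogonal to all `b l` with
`l ≥ j`, hence `j + 1` orthonormal vectors in a space of dimension `j`. -/
theorem eigenvalue_le (hs : T.IsSymmetric) (hT : ∀ i, T (b i) = σ i • b i) (hσ : Antitone σ)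
    (hk : k ≤ N) {F : Fin k → E} (hF : Orthonormal ℝ F) {s : Fin k → ℝ} (hsa : Antitone s)
    (hTF : ∀ j, T (F j) = s j • F j) (j : Fin k) : s j ≤ σ j := by
  by_contra! hlt
  have hzero : ∀ i ≤ j, ∀ l : Fin N, (j : ℕ) ≤ l → ⟪F i, b l⟫_ℝ = 0 := by
    intro i hi l hl
    have h := hs (F i) (b l)
    rw [hTF, hT, real_inner_smul_left, real_inner_smul_right] at h
    have h1 : σ l < s i := (hσ hl).trans_lt (hlt.trans_le (hsa hi))
    have h2 : (s i - σ l) * ⟪F i, b l⟫_ℝ = 0 := by linarith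
    exact (mul_eq_zero.1 h2).resolve_left (by linarith)
  have h1 : ∑ i ∈ Finset.Iic j, ∑ l : Fin N, ⟪F i, b l⟫_ℝ ^ 2 = (j : ℕ) + 1 := by
    simp_rw [sum_inner_sq b, hF.1]
    simp
  have h2 : ∑ i ∈ Finset.Iic j, ∑ l : Fin N, ⟪F i, b l⟫_ℝ ^ 2 ≤
      ∑ l : Fin N, (if (l : ℕ) < j then (1 : ℝ) else 0) := by
    rw [Finset.sum_comm]
    refine Finset.sum_le_sum fun l _ => ?_
    split_ifs with hl
    · have := hF.sum_inner_products_le (b l) (s := Finset.Iic j)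
      rw [b.norm_eq_one] at this
      simpa using this
    · refine (Finset.sum_eq_zero fun i hi => ?_).le
      rw [hzero i (Finset.mem_Iic.1 hi) l (not_lt.1 hl)]
      simp
  rw [h1, sum_fin_ite_lt (by omega) fun _ => 1] at h2
  simp at h2
  linarith

variable [FiniteDimensional ℝ E]

theorem sum_norm_starProjection_sq (b : OrthonormalBasis ι ℝ E) (V : Submodule ℝ E) :
    ∑ i, ‖V.starProjection (b i)‖ ^ 2 = finrank ℝ V := by
  set e := stdOrthonormalBasis ℝ V
  have h : ∀ i, ‖V.starProjection (b i)‖ ^ 2 = ∑ r, ⟪(e r : E), b i⟫_ℝ ^ 2 := by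
    intro i
    have h1 := sum_inner_sq e (V.orthogonalProjectionOnto (b i))
    rw [Submodule.starProjection_apply, ← Submodule.coe_norm, ← h1]
    refine Finset.sum_congr rfl fun r _ => ?_
    rw [Submodule.inner_orthogonalProjectionOnto_eq_of_mem_right, real_inner_comm]
  simp_rw [h]
  rw [Finset.sum_comm]
  simp_rw [sum_inner_sq b, ← Submodule.coe_norm, e.norm_eq_one]
  simp

theorem norm_starProjection_sq_le_one (b : OrthonormalBasis ι ℝ E) (V : Submodule ℝ E) (i : ι) :
    ‖V.starProjection (b i)‖ ^ 2 ≤ 1 := by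
  have := V.norm_starProjection_apply_le (b i)
  rw [b.norm_eq_one] at this
  exact pow_le_one₀ (norm_nonneg _) this

/-- Pythagoras: an approximation `B` of `T` with values in `V` differs from `T` by the part of `T`
orthogonal to `V`, plus the distance from `B` to the compression of `T` to `V`. -/
theorem sum_norm_sub_sq_eq_projection (hT : ∀ i, T (b i) = σ i • b i)
    (V : Submodule ℝ E) {B : E →ₗ[ℝ] E} (hB : ∀ z, B z ∈ V) :
    ∑ i, ‖T (b i) - B (b i)‖ ^ 2 = ∑ i, ‖V.starProjection (T (b i)) - B (b i)‖ ^ 2 +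
      (∑ i : Fin N, σ i ^ 2 - ∑ i : Fin N, σ i ^ 2 * ‖V.starProjection (b i)‖ ^ 2) := by
  have h2 : ∀ i : Fin N, σ i ^ 2 - σ i ^ 2 * ‖V.starProjection (b i)‖ ^ 2 =
      ‖T (b i) - V.starProjection (T (b i))‖ ^ 2 := by
    intro i
    have h := V.norm_sq_eq_add_norm_sq_starProjection (T (b i))
    rw [Submodule.starProjection_orthogonal_val] at h
    rw [hT, map_smul, norm_smul, norm_smul, b.norm_eq_one, mul_one, mul_pow,
      Real.norm_eq_abs, sq_abs] at h
    rw [hT, map_smul]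
    linarith
  rw [← Finset.sum_sub_distrib, ← Finset.sum_add_distrib]
  refine Finset.sum_congr rfl fun i _ => ?_
  rw [h2]
  have h3 : T (b i) - B (b i) =
      (T (b i) - V.starProjection (T (b i))) + (V.starProjection (T (b i)) - B (b i)) := by abel
  rw [h3, norm_add_sq_real, Submodule.starProjection_inner_eq_zero _ _
    (V.sub_mem (V.starProjection_apply_mem _) (hB _))]
  ring

theorem sq_antitone (hσ : Antitone σ) (hσ0 : ∀ i, 0 ≤ σ i) : Antitone fun i => σ i ^ 2 :=
  fun _ j h => pow_le_pow_left₀ (hσ0 j) (hσ h) 2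

theorem sum_sq_mul_norm_starProjection_le (hσ : Antitone σ)
    (hσ0 : ∀ i, 0 ≤ σ i) (hk : k ≤ N) (V : Submodule ℝ E) (hV : finrank ℝ V ≤ k) :
    ∑ i : Fin N, σ i ^ 2 * ‖V.starProjection (b i)‖ ^ 2 ≤ ∑ i ∈ Finset.range k, σ i ^ 2 := by
  refine sum_mul_le_sum_range (w := fun i => σ i ^ 2) hk (sq_antitone hσ hσ0)
    (fun i => sq_nonneg _) (fun i => sq_nonneg _) (norm_starProjection_sq_le_one b V) ?_
  rw [sum_norm_starProjection_sq]
  exact_mod_cast hV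

/-- The Eckart–Young lower bound for approximations with range in a space of dimension `≤ k`. -/
theorem sum_Ico_sq_le_sum_norm_sub_sq (hT : ∀ i, T (b i) = σ i • b i)
    (hσ : Antitone σ) (hσ0 : ∀ i, 0 ≤ σ i) (hk : k ≤ N) (V : Submodule ℝ E)
    (hV : finrank ℝ V ≤ k) {B : E →ₗ[ℝ] E} (hB : ∀ z, B z ∈ V) :
    ∑ i ∈ Finset.Ico k N, σ i ^ 2 ≤ ∑ i, ‖T (b i) - B (b i)‖ ^ 2 := by
  rw [sum_norm_sub_sq_eq_projection hT V hB,
    sum_fin_eq_range_add_Ico hk (fun i => σ i ^ 2)]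
  have h1 := sum_sq_mul_norm_starProjection_le (b := b) hσ hσ0 hk V hV
  have h2 : 0 ≤ ∑ i, ‖V.starProjection (T (b i)) - B (b i)‖ ^ 2 :=
    Finset.sum_nonneg fun _ _ => sq_nonneg _
  linarith

/-- Rigidity in the Eckart–Young bound: an optimal approximation with range in `V` is the
projection of `T` to `V`, and `V` captures the full weight of the `k` largest eigenvalues. -/
theorem eq_projection_of_optimal (hT : ∀ i, T (b i) = σ i • b i)
    (hσ : Antitone σ) (hσ0 : ∀ i, 0 ≤ σ i) (hk : k ≤ N) (V : Submodule ℝ E)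
    (hV : finrank ℝ V ≤ k) {B : E →ₗ[ℝ] E} (hB : ∀ z, B z ∈ V)
    (hopt : ∑ i, ‖T (b i) - B (b i)‖ ^ 2 ≤ ∑ i ∈ Finset.Ico k N, σ i ^ 2) :
    (∀ z, V.starProjection (T z) = B z) ∧
      ∑ i : Fin N, σ i ^ 2 * ‖V.starProjection (b i)‖ ^ 2 =
        ∑ i ∈ Finset.range k, σ i ^ 2 := by
  rw [sum_norm_sub_sq_eq_projection hT V hB,
    sum_fin_eq_range_add_Ico hk (fun i => σ i ^ 2)] at hopt
  have h1 := sum_sq_mul_norm_starProjection_le (b := b) hσ hσ0 hk V hV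
  have h2 : 0 ≤ ∑ i, ‖V.starProjection (T (b i)) - B (b i)‖ ^ 2 :=
    Finset.sum_nonneg fun _ _ => sq_nonneg _
  have h3 : ∑ i, ‖V.starProjection (T (b i)) - B (b i)‖ ^ 2 = 0 := by linarith
  refine ⟨fun z => ?_, by linarith⟩
  rw [Finset.sum_eq_zero_iff_of_nonneg fun _ _ => sq_nonneg _] at h3
  have h4 : V.starProjection.toLinearMap ∘ₗ T = B := by
    refine b.toBasis.ext fun i => ?_
    have := h3 i (Finset.mem_univ i)
    simpa [sub_eq_zero] using this
  rw [← h4]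
  rfl

theorem sum_norm_sq_of_optimal (hT : ∀ i, T (b i) = σ i • b i)
    (hσ : Antitone σ) (hσ0 : ∀ i, 0 ≤ σ i) (hk : k ≤ N) (V : Submodule ℝ E)
    (hV : finrank ℝ V ≤ k) {B : E →ₗ[ℝ] E} (hB : ∀ z, B z ∈ V)
    (hopt : ∑ i, ‖T (b i) - B (b i)‖ ^ 2 ≤ ∑ i ∈ Finset.Ico k N, σ i ^ 2) :
    ∑ i, ‖B (b i)‖ ^ 2 = ∑ i ∈ Finset.range k, σ i ^ 2 := by
  obtain ⟨h1, h2⟩ := eq_projection_of_optimal hT hσ hσ0 hk V hV hB hopt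
  rw [← h2]
  refine Finset.sum_congr rfl fun i _ => ?_
  rw [← h1, hT, map_smul, norm_smul, mul_pow, Real.norm_eq_abs, sq_abs]

/-- Across a spectral gap, the range of an optimal approximation contains the `k` leading
eigenvectors. -/
theorem mem_of_optimal_of_gap (hT : ∀ i, T (b i) = σ i • b i)
    (hσ : Antitone σ) (hσ0 : ∀ i, 0 ≤ σ i) (hk : k ≤ N) (V : Submodule ℝ E)
    (hV : finrank ℝ V ≤ k) {B : E →ₗ[ℝ] E} (hB : ∀ z, B z ∈ V)
    (hopt : ∑ i, ‖T (b i) - B (b i)‖ ^ 2 ≤ ∑ i ∈ Finset.Ico k N, σ i ^ 2)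
    (hgap : σ k < σ (k - 1)) (i : Fin N) (hi : (i : ℕ) < k) : b i ∈ V := by
  obtain ⟨-, h2⟩ := eq_projection_of_optimal hT hσ hσ0 hk V hV hB hopt
  have h := eq_one_of_sum_range_le (w := fun i => σ i ^ 2)
    (p := fun i => ‖V.starProjection (b i)‖ ^ 2) hk (sq_antitone hσ hσ0) (fun i => sq_nonneg _)
    (fun i => sq_nonneg _) (norm_starProjection_sq_le_one b V)
    (by rw [sum_norm_starProjection_sq]; exact_mod_cast hV) h2.ge
    (pow_lt_pow_left₀ hgap (hσ0 k) two_ne_zero) i hi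
  rw [Submodule.mem_iff_norm_starProjection, b.norm_eq_one]
  exact (pow_eq_one_iff_of_nonneg (norm_nonneg _) two_ne_zero).1 h

end Spectral

/-! ### Weighted features and the normalized adjacency operator -/

variable {Xbar X Y : Type*} [Fintype Xbar] [Fintype X] (M : Model Xbar X Y)

namespace Model

theorem deg_eq (x : X) : M.deg x = ∑ xbar, M.P xbar * M.aug xbar x := by
  simp only [deg, adj, Matrix.of_apply]
  rw [Finset.sum_comm]
  refine Finset.sum_congr rfl fun xbar _ => ?_
  rw [← Finset.mul_sum, ← Finset.mul_sum, (M.aug_mem xbar).2, mul_one]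

theorem deg_pos (x : X) : 0 < M.deg x := by
  rw [deg_eq]
  obtain ⟨xbar, h⟩ := M.exists_pos x
  exact Finset.sum_pos' (fun z _ => mul_nonneg (M.P_mem.1 z) ((M.aug_mem z).1 x))
    ⟨xbar, Finset.mem_univ _, h⟩

theorem sqrt_deg_ne_zero (x : X) : √(M.deg x) ≠ 0 := (Real.sqrt_pos.2 (M.deg_pos x)).ne'

theorem sqrt_deg_mul_self (x : X) : √(M.deg x) * √(M.deg x) = M.deg x :=
  Real.mul_self_sqrt (M.deg_pos x).le

theorem sum_deg_mul (g : X → ℝ) :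
    ∑ x, M.deg x * g x = ∑ xbar, M.P xbar * ∑ x, M.aug xbar x * g x := by
  simp_rw [deg_eq, Finset.sum_mul, Finset.mul_sum]
  rw [Finset.sum_comm]
  simp_rw [mul_assoc]

theorem sum_deg : ∑ x, M.deg x = 1 := by
  have := M.sum_deg_mul fun _ => 1
  simpa [(M.aug_mem _).2, M.P_mem.2] using this

theorem adj_nonneg (x x' : X) : 0 ≤ M.adj x x' :=
  Finset.sum_nonneg fun z _ =>
    mul_nonneg (M.P_mem.1 z) (mul_nonneg ((M.aug_mem z).1 x) ((M.aug_mem z).1 x'))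

/-- The `j`-th feature as a vector, weighted so that its Euclidean inner products are expectations
under the law of the augmented samples. -/
def featVec {ι : Type*} (f : X → ι → ℝ) (j : ι) : EuclideanSpace ℝ X :=
  WithLp.toLp 2 fun x => √(M.deg x) * f x j

/-- The operator of the normalized adjacency matrix. -/
def op [DecidableEq X] : EuclideanSpace ℝ X →ₗ[ℝ] EuclideanSpace ℝ X :=
  Matrix.toEuclideanLin M.normAdj

/-- The weighted indicator vector of the augmented samples with label `c`. -/
def labelVec [DecidableEq Y] (c : Y) : EuclideanSpace ℝ X :=
  M.featVec (fun x c => if M.augLabel x = c then 1 else 0) c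

variable {ι : Type*}

theorem featVec_apply (f : X → ι → ℝ) (j : ι) (x : X) :
    M.featVec f j x = √(M.deg x) * f x j := rfl

/-- Every family of vectors comes from features, as the degrees are positive. -/
theorem exists_featVec_eq (G : ι → EuclideanSpace ℝ X) : ∃ f, M.featVec f = G := by
  refine ⟨fun x j => G j x / √(M.deg x), ?_⟩
  ext j x
  rw [featVec_apply, mul_div_cancel₀ _ (M.sqrt_deg_ne_zero x)]

theorem inner_featVec (f : X → ι → ℝ) (j l : ι) :
    ⟪M.featVec f j, M.featVec f l⟫_ℝ = ∑ x, M.deg x * (f x j * f x l) := by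
  simp only [PiLp.inner_apply, featVec_apply, RCLike.inner_apply, conj_trivial]
  refine Finset.sum_congr rfl fun x _ => ?_
  linear_combination (f x j * f x l) * M.sqrt_deg_mul_self x

theorem lossDec_eq {k : ℕ} (f : X → Fin k → ℝ) :
    M.lossDec f = ∑ i, ∑ j,
      (⟪M.featVec f i, M.featVec f j⟫_ℝ - (1 : Matrix (Fin k) (Fin k) ℝ) i j) ^ 2 := by
  simp_rw [inner_featVec]
  rfl

section Spectrum

variable [DecidableEq X]

theorem op_apply (z : EuclideanSpace ℝ X) (x : X) :
    M.op z x = ∑ x', M.normAdj x x' * z x' := rfl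

theorem op_featVec (f : X → ι → ℝ) (j : ι) (x : X) :
    M.op (M.featVec f j) x = (∑ x', M.adj x x' * f x' j) / √(M.deg x) := by
  rw [op_apply, Finset.sum_div]
  refine Finset.sum_congr rfl fun x' _ => ?_
  simp only [normAdj, Matrix.of_apply, featVec_apply]
  have := M.sqrt_deg_ne_zero x
  have := M.sqrt_deg_ne_zero x'
  field_simp

theorem inner_featVec_op (f : X → ι → ℝ) (j : ι) :
    ⟪M.featVec f j, M.op (M.featVec f j)⟫_ℝ = ∑ x, ∑ x', M.adj x x' * (f x j * f x' j) := by
  simp only [PiLp.inner_apply, featVec_apply, RCLike.inner_apply, conj_trivial, op_featVec]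
  refine Finset.sum_congr rfl fun x _ => ?_
  have h : ∑ x', M.adj x x' * (f x j * f x' j) = f x j * ∑ x', M.adj x x' * f x' j := by
    rw [Finset.mul_sum]
    exact Finset.sum_congr rfl fun x' _ => by ring
  rw [h]
  have := M.sqrt_deg_ne_zero x
  field_simp

theorem op_isSymmetric : M.op.IsSymmetric :=
  Matrix.isSymmetric_toEuclideanLin_iff.mpr M.normAdj_isHermitian

/-- An orthonormal basis of eigenvectors of the normalized adjacency matrix, by decreasing
eigenvalue. -/
def eigenbasis : OrthonormalBasis (Fin (Fintype.card X)) ℝ (EuclideanSpace ℝ X) :=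
  M.op_isSymmetric.eigenvectorBasis finrank_euclideanSpace

theorem op_eigenbasis (i : Fin (Fintype.card X)) :
    M.op (M.eigenbasis i) = M.sigma i • M.eigenbasis i := by
  rw [sigma, dif_pos i.2]
  exact M.op_isSymmetric.apply_eigenvectorBasis finrank_euclideanSpace i

/-- The quadratic form is `𝔼_{xbar} (𝔼_{x ∼ 𝒜(· | xbar)} f x)²` for the feature `f` with weighted
vector `z`. -/
theorem inner_op_self_nonneg (z : EuclideanSpace ℝ X) : 0 ≤ ⟪z, M.op z⟫_ℝ := by
  obtain ⟨f, hf⟩ := M.exists_featVec_eq (fun _ : Unit => z)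
  have h := M.inner_featVec_op f ()
  rw [hf] at h
  have h2 : ∑ x, ∑ x', M.adj x x' * (f x () * f x' ()) =
      ∑ xbar, M.P xbar * (∑ x, M.aug xbar x * f x ()) ^ 2 := by
    simp only [adj, Matrix.of_apply, sq, Finset.sum_mul_sum]
    simp_rw [Finset.mul_sum, Finset.sum_mul]
    rw [Finset.sum_comm' (t' := Finset.univ) (s' := fun _ => Finset.univ) (by simp)]
    rw [Finset.sum_comm]
    simp_rw [Finset.sum_comm (s := (Finset.univ : Finset X)) (t := (Finset.univ : Finset Xbar))]
    refine Finset.sum_congr rfl fun _ _ => ?_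
    rw [Finset.sum_comm]
    refine Finset.sum_congr rfl fun _ _ => Finset.sum_congr rfl fun _ _ => by ring
  rw [h, h2]
  exact Finset.sum_nonneg fun _ _ => mul_nonneg (M.P_mem.1 _) (sq_nonneg _)

theorem sigma_nonneg (i : ℕ) : 0 ≤ M.sigma i := by
  by_cases h : i < Fintype.card X
  · have h1 := M.inner_op_self_nonneg (M.eigenbasis ⟨i, h⟩)
    rwa [op_eigenbasis, real_inner_smul_right, real_inner_self_eq_norm_sq,
      M.eigenbasis.norm_eq_one, one_pow, mul_one] at h1
  · rw [sigma, dif_neg h]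

theorem sigma_antitone : Antitone M.sigma := by
  intro i j hij
  by_cases h : j < Fintype.card X
  · rw [sigma, sigma, dif_pos h, dif_pos (hij.trans_lt h)]
    exact M.normAdj_isHermitian.eigenvalues₀_antitone hij
  · nth_rw 1 [sigma]
    rw [dif_neg h]
    exact M.sigma_nonneg i

/-- The squared Frobenius distance of the normalized adjacency matrix to `G diag(s) Gᵀ`, where the
columns of `G` are the weighted features. -/
def approxError [Fintype ι] (f : X → ι → ℝ) (s : ι → ℝ) : ℝ :=
  ∑ i, ‖M.op (M.eigenbasis i) - lowRank s (M.featVec f) (M.eigenbasis i)‖ ^ 2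

theorem approxError_eq [Fintype ι] (f : X → ι → ℝ) (s : ι → ℝ) :
    M.approxError f s = ∑ i ∈ Finset.range (Fintype.card X), M.sigma i ^ 2 +
      (-2 * ∑ j, s j * ⟪M.featVec f j, M.op (M.featVec f j)⟫_ℝ +
        ∑ j, ∑ l, s j * s l * ⟪M.featVec f j, M.featVec f l⟫_ℝ ^ 2) := by
  rw [approxError, sum_norm_sub_lowRank_sq M.op_isSymmetric M.op_eigenbasis,
    Fin.sum_univ_eq_sum_range (fun i => M.sigma i ^ 2)]

variable {k : ℕ}

theorem lossTri_eq (f : X → Fin k → ℝ) (s : Fin k → ℝ) :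
    M.lossTri f s = M.approxError f s -
      ∑ i ∈ Finset.range (Fintype.card X), M.sigma i ^ 2 := by
  have h1 : ∀ x x', f x ⬝ᵥ (Matrix.diagonal s *ᵥ f x') = ∑ j, s j * (f x j * f x' j) := by
    intro x x'
    simp only [dotProduct, Matrix.mulVec_diagonal]
    exact Finset.sum_congr rfl fun j _ => by ring
  have h2 : ∑ x, ∑ x', M.adj x x' * (∑ j, s j * (f x j * f x' j)) =
      ∑ j, s j * ⟪M.featVec f j, M.op (M.featVec f j)⟫_ℝ := by
    simp_rw [inner_featVec_op, Finset.mul_sum]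
    simp_rw [Finset.sum_comm (s := (Finset.univ : Finset X))
      (t := (Finset.univ : Finset (Fin k)))]
    refine Finset.sum_congr rfl fun j _ => Finset.sum_congr rfl fun x _ =>
      Finset.sum_congr rfl fun x' _ => by ring
  have h3 : ∑ x, ∑ x', M.deg x * M.deg x' * (∑ j, s j * (f x j * f x' j)) ^ 2 =
      ∑ j, ∑ l, s j * s l * ⟪M.featVec f j, M.featVec f l⟫_ℝ ^ 2 := by
    simp_rw [inner_featVec, sq, Finset.sum_mul_sum, Finset.mul_sum]
    simp_rw [Finset.sum_comm (s := (Finset.univ : Finset X))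
      (t := (Finset.univ : Finset (Fin k)))]
    refine Finset.sum_congr rfl fun j _ => Finset.sum_congr rfl fun l _ =>
      Finset.sum_congr rfl fun x _ => Finset.sum_congr rfl fun x' _ => by ring
  rw [lossTri, approxError_eq]
  simp_rw [h1]
  rw [h2, h3]
  ring

theorem lossSCL_eq (f : X → Fin k → ℝ) :
    M.lossSCL f = M.approxError f (fun _ => 1) -
      ∑ i ∈ Finset.range (Fintype.card X), M.sigma i ^ 2 := by
  rw [← lossTri_eq, lossTri, lossSCL]
  simp [Matrix.diagonal_one]

end Spectrum

/-! ### Probing error and factorization error -/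

section Probe

variable {ι : Type*} [Fintype ι] [DecidableEq Y] {M} {a : (Y → ℝ) → Y}

/-- A majority vote errs only if at least half of the views are misclassified. -/
theorem ensemble_ne_le (ha : IsArgmax a) (f : X → ι → ℝ) (W : Matrix Y ι ℝ) (xbar : Xbar) :
    (if M.ensemble a f W xbar ≠ M.natLabel xbar then (1 : ℝ) else 0) ≤
      2 * ∑ x, M.aug xbar x *
        (if linPredict a W (f x) ≠ M.natLabel xbar then 1 else 0) := by
  have h0 : ∀ x, 0 ≤ M.aug xbar x := (M.aug_mem xbar).1
  split_ifs with h
  · set p : Y → ℝ := fun c =>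
      ∑ x, M.aug xbar x * (if linPredict a W (f x) = c then 1 else 0) with hp
    have hle : p (M.natLabel xbar) ≤ p (M.ensemble a f W xbar) := ha p _
    have hcompl : ∑ x, M.aug xbar x *
        (if linPredict a W (f x) ≠ M.natLabel xbar then 1 else 0) =
        1 - p (M.natLabel xbar) := by
      rw [eq_sub_iff_add_eq, hp, ← Finset.sum_add_distrib]
      refine (Finset.sum_congr rfl fun x _ => ?_).trans (M.aug_mem xbar).2
      by_cases h : linPredict a W (f x) = M.natLabel xbar <;> simp [h]
    have hdisj : p (M.ensemble a f W xbar) ≤ ∑ x, M.aug xbar x *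
        (if linPredict a W (f x) ≠ M.natLabel xbar then 1 else 0) := by
      refine Finset.sum_le_sum fun x _ => mul_le_mul_of_nonneg_left ?_ (h0 x)
      by_cases h' : linPredict a W (f x) = M.ensemble a f W xbar
      · simp [h', h]
      · rw [if_neg h']
        split_ifs <;> norm_num
    linarith
  · exact mul_nonneg zero_le_two (Finset.sum_nonneg fun x _ => mul_nonneg (h0 x)
      (by split_ifs <;> norm_num))

theorem classError_nonneg (f : X → ι → ℝ) (W : Matrix Y ι ℝ) : 0 ≤ M.classError a f W :=
  Finset.sum_nonneg fun _ _ => mul_nonneg (M.P_mem.1 _) (by split_ifs <;> norm_num)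

theorem probeError_le_classError (f : X → ι → ℝ) (W : Matrix Y ι ℝ) :
    M.probeError a f ≤ M.classError a f W :=
  ciInf_le ⟨0, by rintro _ ⟨W, rfl⟩; exact classError_nonneg f W⟩ W

/-- Features whose weighted vectors lie in the span of those of `f` are linear functions of `f`,
so that probing them is no better than probing `f`. -/
theorem probeError_le_of_mem_span {κ : Type*} [Fintype κ] {f : X → ι → ℝ} {g : X → κ → ℝ}
    (h : ∀ j, M.featVec g j ∈ Submodule.span ℝ (Set.range (M.featVec f))) :
    M.probeError a f ≤ M.probeError a g := by
  choose Q hQ using fun j => (Submodule.mem_span_range_iff_exists_fun ℝ).1 (h j)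
  have hg : ∀ x, g x = Matrix.of Q *ᵥ f x := by
    intro x
    ext j
    have h1 := congrArg (fun z : EuclideanSpace ℝ X => z x) (hQ j)
    simp only [WithLp.ofLp_sum, Finset.sum_apply, PiLp.smul_apply, featVec_apply,
      smul_eq_mul] at h1
    refine mul_left_cancel₀ (M.sqrt_deg_ne_zero x) ?_
    rw [← h1]
    simp only [Matrix.mulVec, dotProduct, Matrix.of_apply, Finset.mul_sum]
    exact Finset.sum_congr rfl fun i _ => by ring
  refine le_ciInf fun W => ?_
  have h2 : M.ensemble a g W = M.ensemble a f (W * Matrix.of Q) := by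
    funext xbar
    simp only [ensemble, linPredict, hg, Matrix.mulVec_mulVec]
    congr!
  have h3 : M.classError a g W = M.classError a f (W * Matrix.of Q) := by
    rw [classError, classError, h2]
  rw [h3]
  exact probeError_le_classError f _

end Probe

section Risk

variable {ι : Type*} [DecidableEq Y]

theorem labelVec_apply (c : Y) (x : X) :
    M.labelVec c x = √(M.deg x) * (if M.augLabel x = c then 1 else 0) := rfl

/-- The two views of a positive pair have different labels with probability at most `2α`. -/
theorem sum_adj_label_ne_le :
    ∑ x, ∑ x', M.adj x x' * (if M.augLabel x ≠ M.augLabel x' then 1 else 0) ≤ 2 * M.alpha := by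
  have h1 : ∀ x : X, ∑ x', M.adj x x' * (if M.augLabel x ≠ M.augLabel x' then 1 else 0) ≤
      ∑ x', ∑ xbar, M.P xbar * (M.aug xbar x * M.aug xbar x') *
        ((if M.natLabel xbar ≠ M.augLabel x then 1 else 0) +
          (if M.natLabel xbar ≠ M.augLabel x' then 1 else 0)) := by
    intro x
    refine Finset.sum_le_sum fun x' _ => ?_
    simp only [adj, Matrix.of_apply]
    rw [Finset.sum_mul]
    refine Finset.sum_le_sum fun xbar _ => mul_le_mul_of_nonneg_left ?_
      (mul_nonneg (M.P_mem.1 _) (mul_nonneg ((M.aug_mem _).1 _) ((M.aug_mem _).1 _)))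
    by_cases h : M.natLabel xbar = M.augLabel x
    · simp [h]
    · simp only [ne_eq, h, not_false_eq_true, if_true]
      split_ifs <;> norm_num
  refine (Finset.sum_le_sum fun x _ => h1 x).trans_eq ?_
  simp_rw [Finset.sum_comm (s := (Finset.univ : Finset X)) (t := (Finset.univ : Finset Xbar))]
  rw [alpha, Finset.mul_sum]
  refine Finset.sum_congr rfl fun xbar _ => ?_
  have h2 : ∀ u : X → ℝ, ∑ x, ∑ x', M.P xbar * (M.aug xbar x * M.aug xbar x') * (u x + u x') =
      2 * (M.P xbar * ∑ x, M.aug xbar x * u x) := by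
    intro u
    have h3 : ∀ x x', M.P xbar * (M.aug xbar x * M.aug xbar x') * (u x + u x') =
        M.P xbar * ((M.aug xbar x * u x) * M.aug xbar x' +
          M.aug xbar x * (M.aug xbar x' * u x')) := fun x x' => by ring
    simp_rw [h3, ← Finset.mul_sum, Finset.sum_add_distrib, ← Finset.mul_sum, ← Finset.sum_mul,
      (M.aug_mem xbar).2]
    ring
  exact h2 fun x => if M.natLabel xbar ≠ M.augLabel x then 1 else 0

variable [Fintype Y]

/-- Bessel's inequality for the label vectors, which are orthogonal of norm at most `1`. -/
theorem sum_inner_labelVec_sq_le (z : EuclideanSpace ℝ X) :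
    ∑ c, ⟪M.labelVec c, z⟫_ℝ ^ 2 ≤ ‖z‖ ^ 2 := by
  have h : ∀ c, ⟪M.labelVec c, z⟫_ℝ ^ 2 ≤ ∑ x, if M.augLabel x = c then z x ^ 2 else 0 := by
    intro c
    have h1 : ⟪M.labelVec c, z⟫_ℝ =
        ∑ x, √(M.deg x) * (if M.augLabel x = c then z x else 0) := by
      simp only [PiLp.inner_apply, labelVec_apply, RCLike.inner_apply, conj_trivial]
      refine Finset.sum_congr rfl fun x _ => ?_
      split_ifs <;> ring
    rw [h1]
    refine (Finset.sum_mul_sq_le_sq_mul_sq _ _ _).trans_eq ?_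
    simp_rw [Real.sq_sqrt (M.deg_pos _).le, M.sum_deg, one_mul]
    refine Finset.sum_congr rfl fun x _ => ?_
    split_ifs <;> simp
  refine (Finset.sum_le_sum fun c _ => h c).trans_eq ?_
  rw [Finset.sum_comm, EuclideanSpace.real_norm_sq_eq]
  simp

/-- A symmetric operator acts on the label vectors with total size at most its Frobenius norm. -/
theorem sum_norm_labelVec_sq_le {κ : Type*} [Fintype κ]
    (b : OrthonormalBasis κ ℝ (EuclideanSpace ℝ X))
    {L : EuclideanSpace ℝ X →ₗ[ℝ] EuclideanSpace ℝ X} (hL : L.IsSymmetric) :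
    ∑ c, ‖L (M.labelVec c)‖ ^ 2 ≤ ∑ i, ‖L (b i)‖ ^ 2 := by
  simp_rw [← sum_inner_sq b (L (M.labelVec _)), hL (M.labelVec _)]
  rw [Finset.sum_comm]
  exact Finset.sum_le_sum fun i _ => M.sum_inner_labelVec_sq_le _

/-- One step of the random walk on the augmentation graph changes the label vectors little. -/
theorem sum_norm_op_labelVec_sub_sq_le [DecidableEq X] :
    ∑ c, ‖M.op (M.labelVec c) - M.labelVec c‖ ^ 2 ≤ 4 * M.alpha := by
  -- `q x c` is the conditional probability that the partner of `x` has label `c`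
  set q : X → Y → ℝ := fun x c =>
    (∑ x', M.adj x x' * (if M.augLabel x' = c then 1 else 0)) / M.deg x with hq
  have hvec : ∀ c x, (M.op (M.labelVec c) - M.labelVec c) x =
      √(M.deg x) * (q x c - if M.augLabel x = c then 1 else 0) := by
    intro c x
    rw [PiLp.sub_apply, labelVec, op_featVec, featVec_apply, hq]
    have h1 := M.sqrt_deg_ne_zero x
    have h2 := (M.deg_pos x).ne'
    have h3 := M.sqrt_deg_mul_self x
    field_simp
    linear_combination (-(∑ x', M.adj x x' * (if M.augLabel x' = c then 1 else 0))) * h3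
  have hq0 : ∀ x c, 0 ≤ q x c := fun x c =>
    div_nonneg (Finset.sum_nonneg fun x' _ => mul_nonneg (M.adj_nonneg x x')
      (by split_ifs <;> norm_num)) (M.deg_pos x).le
  have hqsum : ∀ x, ∑ c, q x c = 1 := by
    intro x
    rw [hq, ← Finset.sum_div, Finset.sum_comm]
    simp_rw [← Finset.mul_sum]
    simp only [Finset.sum_ite_eq, Finset.mem_univ, if_true, mul_one]
    exact div_self (M.deg_pos x).ne'
  have hpt : ∀ x, ∑ c, (q x c - if M.augLabel x = c then 1 else 0) ^ 2 ≤
      2 * (1 - q x (M.augLabel x)) := by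
    intro x
    have h1 : ∀ c, (q x c - if M.augLabel x = c then 1 else 0) ^ 2 ≤
        q x c + (if M.augLabel x = c then 1 - 2 * q x c else 0) := by
      intro c
      have h2 : q x c ≤ 1 := (hqsum x) ▸
        Finset.single_le_sum (fun c _ => hq0 x c) (Finset.mem_univ c)
      have h3 := mul_nonneg (hq0 x c) (sub_nonneg.2 h2)
      split_ifs <;> nlinarith
    refine (Finset.sum_le_sum fun c _ => h1 c).trans_eq ?_
    rw [Finset.sum_add_distrib, hqsum, Finset.sum_ite_eq, if_pos (Finset.mem_univ _)]
    ring
  have hrow : ∀ x, M.deg x * (1 - q x (M.augLabel x)) =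
      ∑ x', M.adj x x' * (if M.augLabel x ≠ M.augLabel x' then 1 else 0) := by
    intro x
    rw [mul_sub, mul_one, hq, mul_div_cancel₀ _ (M.deg_pos x).ne']
    nth_rw 1 [deg]
    rw [← Finset.sum_sub_distrib]
    refine Finset.sum_congr rfl fun x' _ => ?_
    by_cases h : M.augLabel x' = M.augLabel x
    · simp [h]
    · simp [h, Ne.symm h]
  calc ∑ c, ‖M.op (M.labelVec c) - M.labelVec c‖ ^ 2
      = ∑ x, M.deg x * ∑ c, (q x c - if M.augLabel x = c then 1 else 0) ^ 2 := by
        simp_rw [EuclideanSpace.real_norm_sq_eq, hvec, mul_pow, Real.sq_sqrt (M.deg_pos _).le]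
        rw [Finset.sum_comm]
        simp_rw [Finset.mul_sum]
    _ ≤ ∑ x, M.deg x * (2 * (1 - q x (M.augLabel x))) :=
        Finset.sum_le_sum fun x _ => mul_le_mul_of_nonneg_left (hpt x) (M.deg_pos x).le
    _ = 2 * ∑ x, ∑ x', M.adj x x' * (if M.augLabel x ≠ M.augLabel x' then 1 else 0) := by
        rw [Finset.mul_sum]
        exact Finset.sum_congr rfl fun x _ => by rw [← hrow]; ring
    _ ≤ 4 * M.alpha := by linarith [M.sum_adj_label_ne_le]

variable {M} {a : (Y → ℝ) → Y}

/-- A misclassified sample has regression error at least `1/2`. -/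
theorem argmax_ne_le (ha : IsArgmax a) (v : Y → ℝ) (y : Y) :
    (if a v ≠ y then (1 : ℝ) else 0) ≤ 2 * ∑ c, (v c - if y = c then 1 else 0) ^ 2 := by
  split_ifs with h
  · have h1 := Finset.sum_le_sum_of_subset_of_nonneg (Finset.subset_univ {a v, y})
      (fun c _ _ => sq_nonneg (v c - if y = c then 1 else 0))
    rw [Finset.sum_pair h, if_neg (Ne.symm h), if_pos rfl] at h1
    have h2 := ha v y
    nlinarith [sq_nonneg (v (a v) + v y - 1), sq_nonneg (v (a v) - v y)]
  · exact mul_nonneg zero_le_two (Finset.sum_nonneg fun _ _ => sq_nonneg _)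

variable [Fintype ι]

/-- A linear classifier is controlled by its regression error on the labels of the augmented
samples. -/
theorem classError_le (ha : IsArgmax a) (f : X → ι → ℝ) (W : Matrix Y ι ℝ) :
    M.classError a f W ≤ 4 * ∑ x, M.deg x *
      ∑ c, ((W *ᵥ f x) c - if M.augLabel x = c then 1 else 0) ^ 2 + 2 * M.alpha := by
  have h1 : ∀ x : X, ∀ xbar : Xbar,
      (if linPredict a W (f x) ≠ M.natLabel xbar then (1 : ℝ) else 0) ≤
        2 * (∑ c, ((W *ᵥ f x) c - if M.augLabel x = c then 1 else 0) ^ 2) +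
          if M.natLabel xbar ≠ M.augLabel x then 1 else 0 := by
    intro x xbar
    have h2 := argmax_ne_le ha (W *ᵥ f x) (M.augLabel x)
    refine le_trans ?_ (add_le_add_left h2 _)
    rw [linPredict]
    by_cases h : M.natLabel xbar = M.augLabel x
    · simp [h]
    · simp only [ne_eq, h, not_false_eq_true, if_true]
      split_ifs <;> norm_num
  have h3 : ∀ xbar, (if M.ensemble a f W xbar ≠ M.natLabel xbar then (1 : ℝ) else 0) ≤
      4 * (∑ x, M.aug xbar x *
        ∑ c, ((W *ᵥ f x) c - if M.augLabel x = c then 1 else 0) ^ 2) +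
      2 * ∑ x, M.aug xbar x * (if M.natLabel xbar ≠ M.augLabel x then 1 else 0) := by
    intro xbar
    refine (ensemble_ne_le ha f W xbar).trans ?_
    have := Finset.sum_le_sum fun x (_ : x ∈ Finset.univ) =>
      mul_le_mul_of_nonneg_left (h1 x xbar) ((M.aug_mem xbar).1 x)
    refine (mul_le_mul_of_nonneg_left this zero_le_two).trans_eq ?_
    simp_rw [mul_add, Finset.sum_add_distrib, mul_left_comm _ (2 : ℝ), ← Finset.mul_sum]
    ring
  rw [classError, sum_deg_mul, alpha]
  refine (Finset.sum_le_sum fun xbar _ =>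
    mul_le_mul_of_nonneg_left (h3 xbar) (M.P_mem.1 xbar)).trans_eq ?_
  simp_rw [mul_add, Finset.sum_add_distrib, Finset.mul_sum]
  congr 1 <;>
  exact Finset.sum_congr rfl fun _ _ => Finset.sum_congr rfl fun _ _ => by ring_nf

/-- The linear probing error is controlled by how well the features, with any weights, factorize
the normalized adjacency matrix: the linear classifier with rows `s j ⟪G j, u c⟫` regresses the
labels `u c` onto `G diag(s) Gᵀ u c`, which is close to `op u c`, hence to `u c`. -/
theorem probeError_le [DecidableEq X] (ha : IsArgmax a) (f : X → ι → ℝ) (s : ι → ℝ) :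
    M.probeError a f ≤ 8 * M.approxError f s + 34 * M.alpha := by
  set B := lowRank s (M.featVec f) with hB
  set W : Matrix Y ι ℝ := Matrix.of fun c j => s j * ⟪M.featVec f j, M.labelVec c⟫_ℝ with hW
  have hvec : ∀ c x, (B (M.labelVec c) - M.labelVec c) x =
      √(M.deg x) * ((W *ᵥ f x) c - if M.augLabel x = c then 1 else 0) := by
    intro c x
    rw [PiLp.sub_apply, labelVec_apply, hB, lowRank_apply, mul_sub]
    congr 1
    simp only [WithLp.ofLp_sum, Finset.sum_apply, PiLp.smul_apply, featVec_apply, smul_eq_mul,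
      Matrix.mulVec, dotProduct, hW, Matrix.of_apply, Finset.mul_sum]
    exact Finset.sum_congr rfl fun j _ => by ring
  have hreg : ∑ x, M.deg x * ∑ c, ((W *ᵥ f x) c - if M.augLabel x = c then 1 else 0) ^ 2 =
      ∑ c, ‖B (M.labelVec c) - M.labelVec c‖ ^ 2 := by
    simp_rw [EuclideanSpace.real_norm_sq_eq, hvec, mul_pow, Real.sq_sqrt (M.deg_pos _).le]
    rw [Finset.sum_comm]
    simp_rw [Finset.mul_sum]
  have htri : ∀ c, ‖B (M.labelVec c) - M.labelVec c‖ ^ 2 ≤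
      2 * ‖(M.op - B) (M.labelVec c)‖ ^ 2 + 2 * ‖M.op (M.labelVec c) - M.labelVec c‖ ^ 2 := by
    intro c
    have h : B (M.labelVec c) - M.labelVec c =
        (M.op (M.labelVec c) - M.labelVec c) - (M.op - B) (M.labelVec c) := by
      rw [LinearMap.sub_apply]
      abel
    rw [h]
    nlinarith [parallelogram_law_with_norm ℝ (M.op (M.labelVec c) - M.labelVec c)
      ((M.op - B) (M.labelVec c)), mul_self_nonneg
      ‖(M.op (M.labelVec c) - M.labelVec c) + (M.op - B) (M.labelVec c)‖]
  have hsum := Finset.sum_le_sum fun c (_ : c ∈ Finset.univ) => htri c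
  rw [Finset.sum_add_distrib, ← Finset.mul_sum, ← Finset.mul_sum] at hsum
  have hfrob : ∑ c, ‖(M.op - B) (M.labelVec c)‖ ^ 2 ≤ M.approxError f s :=
    M.sum_norm_labelVec_sq_le M.eigenbasis
      (M.op_isSymmetric.sub (lowRank_isSymmetric s (M.featVec f)))
  have hstep := M.sum_norm_op_labelVec_sub_sq_le
  have hclass := classError_le (M := M) ha f W
  rw [hreg] at hclass
  linarith [probeError_le_classError (M := M) (a := a) f W]

end Risk

/-! ### Optimal encoders -/

section Features

variable {M} {k : ℕ}

theorem lossDec_eq_zero_iff {f : X → Fin k → ℝ} :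
    M.lossDec f = 0 ↔ Orthonormal ℝ (M.featVec f) := by
  rw [lossDec_eq, orthonormal_iff_ite, Finset.sum_eq_zero_iff_of_nonneg
    fun _ _ => Finset.sum_nonneg fun _ _ => sq_nonneg _]
  simp_rw [Finset.sum_eq_zero_iff_of_nonneg fun _ _ => sq_nonneg _, Finset.mem_univ, true_imp_iff,
    sq_eq_zero_iff, sub_eq_zero, Matrix.one_apply]

theorem lossDec_nonneg (f : X → Fin k → ℝ) : 0 ≤ M.lossDec f :=
  Finset.sum_nonneg fun _ _ => Finset.sum_nonneg fun _ _ => sq_nonneg _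

theorem finrank_span_featVec_le (f : X → Fin k → ℝ) :
    finrank ℝ (Submodule.span ℝ (Set.range (M.featVec f))) ≤ k := by
  simpa [Set.finrank] using finrank_range_le_card (R := ℝ) (M.featVec f)

theorem probeError_eq_of_span_eq {ι κ : Type*} [Fintype ι] [Fintype κ] [DecidableEq Y]
    {a : (Y → ℝ) → Y} {f : X → ι → ℝ} {g : X → κ → ℝ}
    (h : Submodule.span ℝ (Set.range (M.featVec f)) =
      Submodule.span ℝ (Set.range (M.featVec g))) :
    M.probeError a f = M.probeError a g := by
  apply le_antisymm
  · exact probeError_le_of_mem_span fun j => h ▸ Submodule.subset_span ⟨j, rfl⟩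
  · exact probeError_le_of_mem_span fun j => h ▸ Submodule.subset_span ⟨j, rfl⟩

end Features

section Optimal

variable [DecidableEq X] {k : ℕ}

theorem approxError_eq_of_eigenvectors {f : X → Fin k → ℝ} {s : Fin k → ℝ}
    (hf : Orthonormal ℝ (M.featVec f)) (hs : ∀ j, M.op (M.featVec f j) = s j • M.featVec f j) :
    M.approxError f s =
      ∑ i ∈ Finset.range (Fintype.card X), M.sigma i ^ 2 - ∑ j, s j ^ 2 := by
  rw [approxError_eq]
  simp_rw [hs, real_inner_smul_right, orthonormal_iff_ite.1 hf]
  simp only [ite_pow, one_pow, ne_eq, OfNat.ofNat_ne_zero, not_false_eq_true, zero_pow, mul_ite,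
    mul_one, mul_zero, Finset.sum_ite_eq, Finset.mem_univ, if_true, ← sq]
  ring

theorem sum_castLE_sigma_sq (hk : k ≤ Fintype.card X) :
    ∑ i ∈ Finset.range (Fintype.card X), M.sigma i ^ 2 - ∑ j : Fin k, M.sigma j ^ 2 =
      ∑ i ∈ Finset.Ico k (Fintype.card X), M.sigma i ^ 2 := by
  rw [Fin.sum_univ_eq_sum_range (fun i => M.sigma i ^ 2) k,
    ← Finset.sum_range_add_sum_Ico _ hk]
  ring

/-- The `k` leading eigenvectors, as features, realize the Eckart–Young bound. -/
theorem exists_orthonormal_approxError_eq (hk : k ≤ Fintype.card X) :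
    ∃ f : X → Fin k → ℝ, Orthonormal ℝ (M.featVec f) ∧
      M.approxError f (fun j => M.sigma j) =
        ∑ i ∈ Finset.Ico k (Fintype.card X), M.sigma i ^ 2 := by
  obtain ⟨f, hf⟩ := M.exists_featVec_eq fun j : Fin k => M.eigenbasis (Fin.castLE hk j)
  have ho : Orthonormal ℝ (M.featVec f) := by
    rw [hf]
    exact M.eigenbasis.orthonormal.comp _ (Fin.castLE_injective hk)
  refine ⟨f, ho, ?_⟩
  rw [M.approxError_eq_of_eigenvectors ho, sum_castLE_sigma_sq M hk]
  intro j
  rw [hf]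
  exact M.op_eigenbasis _

variable {M}

theorem IsOptimalSCL.approxError_le {f : X → Fin k → ℝ} (h : M.IsOptimalSCL f)
    (hk : k ≤ Fintype.card X) :
    M.approxError f (fun _ => 1) ≤ ∑ i ∈ Finset.Ico k (Fintype.card X), M.sigma i ^ 2 := by
  obtain ⟨g, -, hg⟩ := M.exists_orthonormal_approxError_eq hk
  -- the comparator absorbs the eigenvalues into the eigenvectors
  have hvec : M.featVec (fun x (j : Fin k) => √(M.sigma j) * g x j) =
      fun j : Fin k => √(M.sigma j) • M.featVec g j := by
    ext j x
    simp only [featVec_apply, PiLp.smul_apply, smul_eq_mul]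
    ring
  have hlow : lowRank (fun _ => 1) (M.featVec (fun x (j : Fin k) => √(M.sigma j) * g x j)) =
      lowRank (fun j : Fin k => M.sigma j) (M.featVec g) := by
    ext1 z
    simp_rw [lowRank_apply, hvec, real_inner_smul_left, smul_smul, one_mul]
    refine Finset.sum_congr rfl fun j _ => ?_
    rw [mul_right_comm, Real.mul_self_sqrt (M.sigma_nonneg _)]
  have h1 := h fun x (j : Fin k) => √(M.sigma j) * g x j
  rw [lossSCL_eq, lossSCL_eq, sub_le_sub_iff_right] at h1
  refine h1.trans_eq ?_
  rw [← hg, approxError, approxError, hlow]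

theorem isImportance_sigma : IsImportance fun j : Fin k => M.sigma j :=
  ⟨fun _ _ h => M.sigma_antitone h, fun _ => M.sigma_nonneg _⟩

theorem IsOptimalTriCL.approxError_add_lossDec_le {f : X → Fin k → ℝ} {s : Fin k → ℝ}
    (h : M.IsOptimalTriCL f s) (hk : k ≤ Fintype.card X) :
    M.approxError f s + M.lossDec f ≤
      ∑ i ∈ Finset.Ico k (Fintype.card X), M.sigma i ^ 2 := by
  obtain ⟨g, hgo, hg⟩ := M.exists_orthonormal_approxError_eq hk
  have h1 := h.2 g _ (isImportance_sigma (M := M))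
  rw [lossTriCL, lossTriCL, lossTri_eq, lossTri_eq, hg, lossDec_eq_zero_iff.2 hgo] at h1
  linarith

theorem IsOptimalTriCL.approxError_le {f : X → Fin k → ℝ} {s : Fin k → ℝ}
    (h : M.IsOptimalTriCL f s) (hk : k ≤ Fintype.card X) :
    M.approxError f s ≤ ∑ i ∈ Finset.Ico k (Fintype.card X), M.sigma i ^ 2 := by
  linarith [h.approxError_add_lossDec_le hk, lossDec_nonneg (M := M) f]

/-- The factorization term alone is at least the Eckart–Young bound, so the decorrelation loss of
an optimal triCL solution vanishes. -/
theorem IsOptimalTriCL.orthonormal {f : X → Fin k → ℝ} {s : Fin k → ℝ}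
    (h : M.IsOptimalTriCL f s) (hk : k ≤ Fintype.card X) :
    Orthonormal ℝ (M.featVec f) := by
  have h1 := h.approxError_add_lossDec_le hk
  have h2 : ∑ i ∈ Finset.Ico k (Fintype.card X), M.sigma i ^ 2 ≤ M.approxError f s :=
    sum_Ico_sq_le_sum_norm_sub_sq M.op_eigenbasis M.sigma_antitone M.sigma_nonneg hk _
      (finrank_span_featVec_le f) (lowRank_mem_span s (M.featVec f))
  exact lossDec_eq_zero_iff.1 (le_antisymm (by linarith) (lossDec_nonneg f))

/-- The features of an optimal triCL solution are eigenvectors, with the importances as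
eigenvalues: `F diag(s) Fᵀ` is the projection of the operator to the span of `F`, and both are
symmetric. -/
theorem IsOptimalTriCL.op_featVec_eq {f : X → Fin k → ℝ} {s : Fin k → ℝ}
    (h : M.IsOptimalTriCL f s) (hk : k ≤ Fintype.card X) (j : Fin k) :
    M.op (M.featVec f j) = s j • M.featVec f j := by
  obtain ⟨h1, -⟩ := eq_projection_of_optimal M.op_eigenbasis M.sigma_antitone M.sigma_nonneg hk _
    (finrank_span_featVec_le f) (lowRank_mem_span s (M.featVec f)) (h.approxError_le hk)
  have hmem : M.featVec f j ∈ Submodule.span ℝ (Set.range (M.featVec f)) :=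
    Submodule.subset_span ⟨j, rfl⟩
  have h2 : M.op (M.featVec f j) = lowRank s (M.featVec f) (M.featVec f j) := by
    refine ext_inner_right ℝ fun z => ?_
    rw [M.op_isSymmetric, lowRank_isSymmetric, ← h1, ← Submodule.inner_starProjection_left_eq_right,
      Submodule.starProjection_eq_self_iff.2 hmem]
  rw [h2, lowRank_apply]
  simp_rw [orthonormal_iff_ite.1 (h.orthonormal hk)]
  simp

/-- The importances of an optimal triCL solution are the `k` largest eigenvalues. -/
theorem IsOptimalTriCL.eq_sigma {f : X → Fin k → ℝ} {s : Fin k → ℝ}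
    (h : M.IsOptimalTriCL f s) (hk : k ≤ Fintype.card X) (j : Fin k) : s j = M.sigma j := by
  have hle : ∀ i ∈ Finset.univ, s i ^ 2 ≤ M.sigma i ^ 2 := fun i _ =>
    pow_le_pow_left₀ (h.1.2 i) (eigenvalue_le M.op_isSymmetric M.op_eigenbasis M.sigma_antitone hk
      (h.orthonormal hk) h.1.1 (h.op_featVec_eq hk) i) 2
  have hsum : ∑ i, s i ^ 2 = ∑ i : Fin k, M.sigma i ^ 2 := by
    refine le_antisymm (Finset.sum_le_sum hle) ?_
    have h1 := h.approxError_le hk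
    rw [M.approxError_eq_of_eigenvectors (h.orthonormal hk) (h.op_featVec_eq hk),
      ← sum_castLE_sigma_sq M hk] at h1
    linarith
  exact (pow_left_inj₀ (h.1.2 j) (M.sigma_nonneg j) two_ne_zero).1
    ((Finset.sum_eq_sum_iff_of_le hle).1 hsum j (Finset.mem_univ j))

theorem IsOptimalTriCL.approxError_topFeatures {f : X → Fin k → ℝ} {s : Fin k → ℝ}
    (h : M.IsOptimalTriCL f s) (hk : k ≤ Fintype.card X) {m : ℕ} (hm : m ≤ k) :
    M.approxError (topFeatures f m hm) (fun j => M.sigma j) =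
      ∑ i ∈ Finset.Ico m (Fintype.card X), M.sigma i ^ 2 := by
  rw [M.approxError_eq_of_eigenvectors, sum_castLE_sigma_sq M (hm.trans hk)]
  · exact (h.orthonormal hk).comp _ (Fin.castLE_injective hm)
  · intro j
    have := h.op_featVec_eq hk (Fin.castLE hm j)
    rw [h.eq_sigma hk] at this
    exact this

/-- Across a spectral gap, weighted features that are optimal for the factorization span the space
of the `k` leading eigenvectors. -/
theorem span_featVec_eq_of_gap {f : X → Fin k → ℝ} {s : Fin k → ℝ} (hk : k ≤ Fintype.card X)
    (h : M.approxError f s ≤ ∑ i ∈ Finset.Ico k (Fintype.card X), M.sigma i ^ 2)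
    (hgap : M.sigma k < M.sigma (k - 1)) :
    Submodule.span ℝ (Set.range fun j : Fin k => M.eigenbasis (Fin.castLE hk j)) =
      Submodule.span ℝ (Set.range (M.featVec f)) := by
  refine Submodule.eq_of_le_of_finrank_le (Submodule.span_le.2 ?_) ?_
  · rintro _ ⟨j, rfl⟩
    exact mem_of_optimal_of_gap M.op_eigenbasis M.sigma_antitone M.sigma_nonneg hk _
      (finrank_span_featVec_le f) (lowRank_mem_span s (M.featVec f)) h hgap _ j.2
  · refine (finrank_span_featVec_le f).trans_eq ?_
    rw [finrank_span_eq_card, Fintype.card_fin]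
    exact (M.eigenbasis.orthonormal.comp _ (Fin.castLE_injective hk)).linearIndependent

end Optimal

/-! ### Random features of an optimal SCL encoder -/

section Random

variable {k m : ℕ}

/-- A uniformly random `m`-subset of `Fin k` misses `j` with probability `1 - m / k`. -/
theorem sum_powersetCard_notMem (hm : m ≤ k) (j : Fin k) :
    (∑ T ∈ Finset.powersetCard m (Finset.univ : Finset (Fin k)),
      (if j ∈ T then (0 : ℝ) else 1)) = (1 - (m : ℝ) / k) * k.choose m := by
  have h1 : (Finset.powersetCard m (Finset.univ : Finset (Fin k))).filter (fun T => j ∉ T) =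
      Finset.powersetCard m (Finset.univ.erase j) := by
    ext T
    simp only [Finset.mem_filter, Finset.mem_powersetCard, Finset.subset_univ, true_and,
      Finset.subset_erase]
    tauto
  have h2 : (∑ T ∈ Finset.powersetCard m (Finset.univ : Finset (Fin k)),
      (if j ∈ T then (0 : ℝ) else 1)) = (k - 1).choose m := by
    simp_rw [← ite_not (p := j ∈ _)]
    rw [Finset.sum_boole, h1, Finset.card_powersetCard, Finset.card_erase_of_mem
      (Finset.mem_univ j), Finset.card_fin]
  obtain ⟨n, rfl⟩ : ∃ n, k = n + 1 := ⟨k - 1, by have := j.2; omega⟩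
  have h3 := congrArg (Nat.cast : ℕ → ℝ) (Nat.choose_mul_succ_eq n m)
  push_cast [Nat.cast_sub hm] at h3
  rw [h2, Nat.add_sub_cancel]
  push_cast
  field_simp
  linarith

variable [DecidableEq X] {M}

/-- Discarding the features outside `T` from an optimal factorization `F Fᵀ` costs at most the
squared correlations that involve a discarded feature, on top of the optimal error. -/
theorem IsOptimalSCL.approxError_selectFeatures_le {f : X → Fin k → ℝ} (h : M.IsOptimalSCL f)
    (hk : k ≤ Fintype.card X) (T : Finset (Fin k)) :
    M.approxError (selectFeatures f T) (fun _ => 1) ≤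
      ∑ j, (∑ l, ⟪M.featVec f j, M.featVec f l⟫_ℝ ^ 2) * (if j ∈ T then 0 else 1) +
        ∑ i ∈ Finset.Ico k (Fintype.card X), M.sigma i ^ 2 := by
  set V := Submodule.span ℝ (Set.range (M.featVec f)) with hV
  have hsel : ∀ z, lowRank (fun _ => 1) (M.featVec (selectFeatures f T)) z =
      lowRank (fun _ => 1) (M.featVec f) z -
        lowRank (fun j => if j ∈ T then 0 else 1) (M.featVec f) z := by
    intro z
    have hval : ∀ j : T, M.featVec (selectFeatures f T) j = M.featVec f j := fun _ => rfl
    simp only [lowRank_apply, hval]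
    rw [← Finset.sum_sub_distrib, Finset.univ_eq_attach,
      Finset.sum_attach T fun j => ((1 : ℝ) * ⟪M.featVec f j, z⟫_ℝ) • M.featVec f j,
      ← Finset.sum_subset (Finset.subset_univ T)]
    · refine Finset.sum_congr rfl fun j hj => ?_
      simp [hj]
    · intro j _ hj
      simp [hj]
  have hmem : ∀ z, lowRank (fun _ => 1) (M.featVec (selectFeatures f T)) z ∈ V := fun z => by
    rw [hsel]
    exact V.sub_mem (lowRank_mem_span _ _ z) (lowRank_mem_span _ _ z)
  obtain ⟨h1, h2⟩ := eq_projection_of_optimal M.op_eigenbasis M.sigma_antitone M.sigma_nonneg hk V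
    (finrank_span_featVec_le f) (lowRank_mem_span _ (M.featVec f)) (h.approxError_le hk)
  rw [approxError, sum_norm_sub_sq_eq_projection M.op_eigenbasis V hmem, h2,
    sum_fin_eq_range_add_Ico hk fun i => M.sigma i ^ 2, add_sub_cancel_left]
  simp_rw [h1, hsel, sub_sub_cancel]
  rw [sum_norm_lowRank_sq]
  rw [add_le_add_iff_right]
  refine Finset.sum_le_sum fun j _ => ?_
  rw [Finset.sum_mul]
  refine Finset.sum_le_sum fun l _ => ?_
  rw [mul_comm]
  refine mul_le_mul_of_nonneg_left ?_ (sq_nonneg _)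
  split_ifs <;> norm_num

/-- The squared Frobenius norm of `F Fᵀ`, for an optimal SCL encoder `F`. -/
theorem IsOptimalSCL.sum_inner_sq_eq {f : X → Fin k → ℝ} (h : M.IsOptimalSCL f)
    (hk : k ≤ Fintype.card X) :
    ∑ j, ∑ l, ⟪M.featVec f j, M.featVec f l⟫_ℝ ^ 2 = ∑ i ∈ Finset.range k, M.sigma i ^ 2 := by
  rw [← sum_norm_sq_of_optimal M.op_eigenbasis M.sigma_antitone M.sigma_nonneg hk _
    (finrank_span_featVec_le f) (lowRank_mem_span _ (M.featVec f)) (h.approxError_le hk),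
    sum_norm_lowRank_sq]
  simp

theorem IsOptimalSCL.randomProbeError_le [Fintype Y] [DecidableEq Y] {a : (Y → ℝ) → Y}
    (ha : IsArgmax a) {f : X → Fin k → ℝ} (h : M.IsOptimalSCL f) (hk : k ≤ Fintype.card X)
    (hm : m ≤ k) : M.randomProbeError a f m ≤ M.boundRandom 8 34 k m := by
  have hpos : (0 : ℝ) < k.choose m := by exact_mod_cast Nat.choose_pos hm
  rw [randomProbeError, div_le_iff₀ hpos]
  set t := ∑ i ∈ Finset.Ico k (Fintype.card X), M.sigma i ^ 2 with ht
  set r : Fin k → ℝ := fun j => ∑ l, ⟪M.featVec f j, M.featVec f l⟫_ℝ ^ 2 with hr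
  have h1 : ∀ T : Finset (Fin k), M.probeError a (selectFeatures f T) ≤
      8 * (∑ j, r j * (if j ∈ T then 0 else 1)) + (8 * t + 34 * M.alpha) := by
    intro T
    have := h.approxError_selectFeatures_le hk T
    linarith [probeError_le (M := M) ha (selectFeatures f T) fun _ => 1]
  refine (Finset.sum_le_sum fun T _ => h1 T).trans_eq ?_
  rw [Finset.sum_add_distrib, ← Finset.mul_sum, Finset.sum_comm]
  simp_rw [← Finset.mul_sum, sum_powersetCard_notMem hm]
  rw [← Finset.sum_mul, hr, h.sum_inner_sq_eq hk, Finset.sum_const, Finset.card_powersetCard,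
    Finset.card_fin, nsmul_eq_mul, boundRandom]
  ring

end Random

/-! ### Comparison of the bounds -/

section Bounds

variable [DecidableEq X] {k m : ℕ}

theorem boundRandom_sub_boundTop [DecidableEq Y] (c₁ c₂ : ℝ) (hm1 : 1 ≤ m) (hm : m ≤ k)
    (hk : k ≤ Fintype.card X) :
    M.boundRandom c₁ c₂ k m - M.boundTop c₁ c₂ m = c₁ * M.gap k m := by
  have hk0 : (k : ℝ) ≠ 0 := Nat.cast_ne_zero.2 (by omega)
  have hm0 : (m : ℝ) ≠ 0 := by positivity
  rw [boundRandom, boundTop, gap, ← Finset.sum_Ico_consecutive _ hm hk,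
    ← Finset.sum_range_add_sum_Ico _ hm]
  rcases hm.eq_or_lt with rfl | hlt
  · simp [hm0]
  · have hkm : (k : ℝ) - m ≠ 0 := by
      have : (m : ℝ) < k := by exact_mod_cast hlt
      exact (sub_pos.2 this).ne'
    field_simp
    ring

theorem gap_nonneg (hm1 : 1 ≤ m) (hm : m ≤ k) : 0 ≤ M.gap k m := by
  rcases hm.eq_or_lt with rfl | hlt
  · simp [gap]
  have hm0 : (0 : ℝ) < m := by positivity
  have hkm : (0 : ℝ) < k - m := by
    have : (m : ℝ) < k := by exact_mod_cast hlt
    linarith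
  have hanti := sq_antitone M.sigma_antitone M.sigma_nonneg
  have h1 : (m : ℝ) * M.sigma m ^ 2 ≤ ∑ i ∈ Finset.range m, M.sigma i ^ 2 := by
    have := Finset.card_nsmul_le_sum (Finset.range m) (fun i => M.sigma i ^ 2) (M.sigma m ^ 2)
      fun i hi => hanti (Finset.mem_range.1 hi).le
    simpa using this
  have h2 : ∑ i ∈ Finset.Ico m k, M.sigma i ^ 2 ≤ ((k : ℝ) - m) * M.sigma m ^ 2 := by
    have := Finset.sum_le_card_nsmul (Finset.Ico m k) (fun i => M.sigma i ^ 2) (M.sigma m ^ 2)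
      fun i hi => hanti (Finset.mem_Ico.1 hi).1
    simpa [Nat.cast_sub hm] using this
  refine mul_nonneg (by positivity) (sub_nonneg.2 ?_)
  rw [one_div_mul_eq_div, one_div_mul_eq_div]
  calc _ ≤ M.sigma m ^ 2 := by rw [div_le_iff₀ hkm]; linarith
    _ ≤ _ := by rw [le_div_iff₀ hm0]; linarith

end Bounds

end Model

end TriCL

end

theorem theorem2 :
    ∃ c₁ c₂ : ℝ, 0 < c₁ ∧ 0 < c₂ ∧
      ∀ (Xbar X Y : Type*) [Fintype Xbar] [Fintype X] [Fintype Y] [DecidableEq X] [DecidableEq Y]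
        (M : TriCL.Model Xbar X Y) (a : (Y → ℝ) → Y), TriCL.IsArgmax a →
      ∀ (k : ℕ), 1 ≤ k → k ≤ Fintype.card X →
      ∀ (fSCL fTri : X → Fin k → ℝ) (s : Fin k → ℝ),
        M.IsOptimalSCL fSCL → M.IsOptimalTriCL fTri s →
        -- all features; `σ_k > σ_{k+1}` (with `σ_{N+1} = 0`) is used only for the equality
        (M.sigma k < M.sigma (k - 1) → M.probeError a fSCL = M.probeError a fTri) ∧
        M.probeError a fSCL ≤ M.boundTop c₁ c₂ k ∧
        M.probeError a fTri ≤ M.boundTop c₁ c₂ k ∧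
        -- `m` features
        ∀ (m : ℕ), 1 ≤ m → ∀ hm : m ≤ k,
          M.probeError a (TriCL.topFeatures fTri m hm) ≤ M.boundTop c₁ c₂ m ∧
          M.randomProbeError a fSCL m ≤ M.boundRandom c₁ c₂ k m ∧
          M.gap k m ≤ M.boundRandom c₁ c₂ k m - M.boundTop c₁ c₂ m ∧
          0 ≤ M.gap k m := by
  refine ⟨8, 34, by norm_num, by norm_num, ?_⟩
  intro Xbar X Y _ _ _ _ _ M a ha k _ hk fSCL fTri s hSCL hTri
  refine ⟨fun hgap => ?_, ?_, ?_, fun m hm1 hm => ⟨?_, hSCL.randomProbeError_le ha hk hm, ?_,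
    M.gap_nonneg hm1 hm⟩⟩
  · exact TriCL.Model.probeError_eq_of_span_eq
      ((TriCL.Model.span_featVec_eq_of_gap hk (hSCL.approxError_le hk) hgap).symm.trans
        (TriCL.Model.span_featVec_eq_of_gap hk (hTri.approxError_le hk) hgap))
  · rw [TriCL.Model.boundTop]
    linarith [TriCL.Model.probeError_le (M := M) ha fSCL fun _ => 1, hSCL.approxError_le hk]
  · rw [TriCL.Model.boundTop]
    linarith [TriCL.Model.probeError_le (M := M) ha fTri s, hTri.approxError_le hk]
  · rw [TriCL.Model.boundTop, ← hTri.approxError_topFeatures hk hm]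
    exact TriCL.Model.probeError_le ha _ _
  · rw [M.boundRandom_sub_boundTop 8 34 hm1 hm hk]
    linarith [M.gap_nonneg hm1 hm]
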